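/- Let $L$ be a functional first-order language and $\mathcal B$ an $L$-algebra. All algebras, and in particular all subalgebras, are nonempty. For a finite set $X=\{x_1,\dots,x_n\}$ let $\mathrm{At}_L(X)$ be the set of equations $t=s$ between $L$-terms in the variables $X$. For $S\subseteq \mathrm{At}_L(X)$ let $V_{\mathcal B}(S)\subseteq B^n$ be the set of solutions of $S$ in $\mathcal B$ (such sets are the algebraic sets over $\mathcal B$), and let $\mathrm{Rad}_{\mathcal B}(S)$ be the largest system with the same solutions in $\mathcal B$ as $S$, i.e. the set of all equations that hold at every point of $V_{\mathcal B}(S)$. A system $S$ is a radical ideal over $\mathcal B$ if $S=\mathrm{Rad}_{\mathcal B}(S)$. The coordinate algebra of $Y=V_{\mathcal B}(S)$ is the quotient of the algebra of $L$-terms in $X$ by the congruence $t\sim s\Leftrightarrow (t=s)\in\mathrm{Rad}_{\mathcal B}(S)$; a coordinate algebra over $\mathcal B$ is an algebra isomorphic to the coordinate algebra of some algebraic set over $\mathcal B$. For a class $\mathbf K$ of $L$-algebras, and up to isomorphism, let $\mathbf S(\mathbf K)$ be the class of subalgebras of algebras from $\mathbf K$; $\mathbf P(\mathbf K)$ the class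 of direct products of algebras from $\mathbf K$ (the empty product is the trivial algebra); $\underrightarrow{\mathbf L}(\mathbf K)$ the class of direct limits of direct systems of algebras from $\mathbf K$ over nonempty directed partially ordered sets; $\underrightarrow{\mathbf L}_s(\mathbf K)$ the class of such limits of epimorphic systems (all maps are onto); $\mathbf{L_{fg}}(\mathbf K)$ the class of algebras all of whose finitely generated subalgebras belong to $\mathbf K$; $\mathbf{Res}(\mathbf K)$ the class of algebras $\mathcal C$ such that any two distinct elements of $\mathcal C$ are separated by a homomorphism from $\mathcal C$ to an algebra in $\mathbf K$; $\mathbf{Pvar}(\mathbf K)$ the least prevariety (class closed under $\mathbf S$ and $\mathbf P$) that includes $\mathbf K$; $\mathbf{Qvar}(\mathbf K)$ the class of algebras that satisfy every quasi-identity true in all algebras of $\mathbf K$; and $\mathbf K_\omega$ the class of finitely generated algebras from $\mathbf K$. Write $\mathbf{Qvar}(\mathcal B)$ for $\mathbf{Qvar}(\{\mathcal B\})$, etc. **Theorem.** The following conditions are equivalent. 1. $\mathcal B$ is $\mathrm q_\omega$-compact: for any finite set $X$, any $S\subseteq\mathrm{At}_L(X)$ and any equation $(t_0=s_0)\in\mathrm{At}_L(X)$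 with $V_{\mathcal B}(S)\subseteq V_{\mathcal B}(t_0=s_0)$ there is a finite $S_0\subseteq S$ with $V_{\mathcal B}(S)\subseteq V_{\mathcal B}(S_0)\subseteq V_{\mathcal B}(t_0=s_0)$. 2. For any finite set $X$, any $S\subseteq\mathrm{At}_L(X)$ and any $c\in\mathrm{Rad}_{\mathcal B}(S)$ there is a finite $S_c\subseteq S$ with $c\in\mathrm{Rad}_{\mathcal B}(S_c)$. 3. For any finite set $X$, any $S\subseteq\mathrm{At}_L(X)$ and any $(t_0=s_0)\in\mathrm{At}_L(X)$, if the (possibly infinite) formula $\forall x_1\dots\forall x_n\,\bigl(\bigwedge_{(t=s)\in S}t(\bar x)=s(\bar x)\to t_0(\bar x)=s_0(\bar x)\bigr)$ holds in $\mathcal B$, then for some finite $S_c\subseteq S$ the quasi-identity $\forall x_1\dots\forall x_n\,\bigl(\bigwedge_{(t=s)\in S_c}t(\bar x)=s(\bar x)\to t_0(\bar x)=s_0(\bar x)\bigr)$ holds in $\mathcal B$. 4. For any finite set $X$, any $S\subseteq\mathrm{At}_L(X)$ and any $(t_0=s_0)\in\mathrm{At}_L(X)$, if every finite subset of $T=S\cup\{\neg(t_0=s_0)\}$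 is satisfiable in $\mathcal B$, then $T$ is satisfiable in $\mathcal B$. 5. Every finitely generated algebra from $\mathbf{Qvar}(\mathcal B)$ is a coordinate algebra over $\mathcal B$. 6. $\mathbf{Qvar}(\mathcal B)_\omega=\mathbf{Pvar}(\mathcal B)_\omega$. 7. $\mathbf{Qvar}(\mathcal B)=\mathbf{L_{fg}}\,\mathbf{Res}(\mathcal B)$. 8. $\underrightarrow{\mathbf L}_s\,\mathbf S\mathbf P(\mathcal B)=\mathbf{L_{fg}}\,\mathbf S\mathbf P(\mathcal B)$. 9. $\underrightarrow{\mathbf L}\,\mathbf S\mathbf P(\mathcal B)=\mathbf{L_{fg}}\,\mathbf S\mathbf P(\mathcal B)$. 10. For any finite set $X$ and any $S\subseteq\mathrm{At}_L(X)$, $\mathrm{Rad}_{\mathcal B}(S)=\bigcup_{S_0}\mathrm{Rad}_{\mathcal B}(S_0)$, where $S_0$ runs over all finite subsystems of $S$. 11. For any finite set $X$, any nonempty directed partially ordered set $I$ and any family $\{S_i\}_{i\in I}$ of radical ideals over $\mathcal B$ in $\mathrm{At}_L(X)$ with $i\le j\Leftrightarrow S_i\subseteq S_j$, the union $\bigcup_{i\in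 I}S_i$ is a radical ideal over $\mathcal B$. 12. For any finite set $X$ and any epimorphic direct system $(I,\mathcal C_i,h_{ij})$ (over a nonempty directed partially ordered set $I$) of coordinate algebras over $\mathcal B$, each generated by (the image of) $X$ and with $h_{ij}(x)=x$ for $x\in X$, $i\le j$, the direct limit $\varinjlim\mathcal C_i$ is a coordinate algebra over $\mathcal B$. -/

import Mathlib

universe u v w c

namespace UAG

open FirstOrder FirstOrder.Language

section Formulas

/-- Equations `t = s` in the variables `x_1, …, x_n`, i.e. the atomic formulas of a functional
language, given by their two sides. -/
abbrev Eqn (L : FirstOrder.Language.{u, v}) (n : ℕ) : Type u := L.Term (Fin n) × L.Term (Fin n)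

/-- The equation as a first-order formula. -/
def Eqn.toFormula {L : FirstOrder.Language.{u, v}} {n : ℕ} (e : Eqn L n) : L.Formula (Fin n) :=
  Term.equal e.1 e.2

/-- The quasi-identity `∀ x_1 … ∀ x_n (⋀_{(t = s) ∈ S} t = s → t₀ = s₀)` for a finite set `S`. -/
noncomputable def quasiIdentity {L : FirstOrder.Language.{u, v}} {n : ℕ} (S : Finset (Eqn L n))
    (e : Eqn L n) : L.Sentence :=
  Formula.iAlls (Fin n)
    (Formula.relabel Sum.inr
      ((Formula.iInf fun p : S => (p : Eqn L n).toFormula).imp e.toFormula))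

def IsQuasiIdentity {L : FirstOrder.Language.{u, v}} (φ : L.Sentence) : Prop :=
  ∃ (n : ℕ) (S : Finset (Eqn L n)) (e : Eqn L n), φ = quasiIdentity S e

end Formulas

/-- An algebra in the functional language `L`: a nonempty set with an interpretation of the
symbols of `L`. (The functional language assumption,
that `L` has no relation symbols, is the instance `L.IsAlgebraic` where it matters.) -/
structure Alg (L : FirstOrder.Language.{u, v}) : Type (max u v (c + 1)) where
  Carrier : Type c
  [str : L.Structure Carrier]
  [nonempty : Nonempty Carrier]

instance (L : FirstOrder.Language.{u, v}) : CoeSort (Alg.{u, v, c} L) (Type c) := ⟨Alg.Carrier⟩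

instance {L : FirstOrder.Language.{u, v}} (A : Alg.{u, v, c} L) : L.Structure A := A.str

instance {L : FirstOrder.Language.{u, v}} (A : Alg.{u, v, c} L) : Nonempty A := A.nonempty

section Geometry

variable {L : FirstOrder.Language.{u, v}} (B : Alg.{u, v, c} L) {n : ℕ}

/-- The set of solutions in `B` of one equation. -/
def solEq (e : Eqn L n) : Set (Fin n → B) := {b | e.1.realize b = e.2.realize b}

/-- The set `V_B(S)` of solutions in `B` of a system of equations. -/
def solSet (S : Set (Eqn L n)) : Set (Fin n → B) :=
  {b | ∀ e ∈ S, e.1.realize b = e.2.realize b}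

/-- `Y` is an algebraic set over `B`. -/
def IsAlgebraicSet (Y : Set (Fin n → B)) : Prop := ∃ S : Set (Eqn L n), Y = solSet B S

/-- The radical `Rad(Y)`: all equations that hold at every point of `Y`. -/
def radSet (Y : Set (Fin n → B)) : Set (Eqn L n) := {e | Y ⊆ solEq B e}

/-- The radical `Rad_B(S)` of a system of equations. -/
def rad (S : Set (Eqn L n)) : Set (Eqn L n) := radSet B (solSet B S)

/-- The radical is the largest system with the same solutions in `B`. -/
theorem rad_isGreatest (S : Set (Eqn L n)) :
    IsGreatest {S' : Set (Eqn L n) | solSet B S' = solSet B S} (rad B S) := by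
  constructor
  · ext b
    exact ⟨fun h e he => h e (fun b' hb' => hb' e he), fun h e he => he h⟩
  · intro S' hS' e he b hb
    have hb' : b ∈ solSet B S' := by
      rw [show solSet B S' = solSet B S from hS']; exact hb
    exact hb' e he

/-- A radical ideal over `B` is a system equal to its own radical. Such an `S`, a set of pairs
of terms, is also the graph of the congruence `θ_S` on the term algebra. -/
def IsRadicalIdeal (S : Set (Eqn L n)) : Prop := S = rad B S

/-- `B` is `q_ω`-compact. -/
def IsQOmegaCompact : Prop :=
  ∀ (n : ℕ) (S : Set (Eqn L n)) (e : Eqn L n), solSet B S ⊆ solEq B e →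
    ∃ S₀ : Set (Eqn L n), S₀ ⊆ S ∧ S₀.Finite ∧
      solSet B S ⊆ solSet B S₀ ∧ solSet B S₀ ⊆ solEq B e

/-- The possibly infinite formula `∀ x_1 … ∀ x_n (⋀_{(t = s) ∈ S} t = s → t₀ = s₀)` holds
in `B`. -/
def HoldsInfQuasiIdentity (S : Set (Eqn L n)) (e : Eqn L n) : Prop :=
  ∀ b : Fin n → B, (∀ p ∈ S, p.toFormula.Realize b) → e.toFormula.Realize b

/-- The set of formulas `T` is satisfiable (realized) in `B`. -/
def SatisfiableIn (T : Set (L.Formula (Fin n))) : Prop :=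
  ∃ b : Fin n → B, ∀ φ ∈ T, φ.Realize b

/-- Every finite subset of `T` is satisfiable in `B`. -/
def FinitelySatisfiableIn (T : Set (L.Formula (Fin n))) : Prop :=
  ∀ T₀ : Set (L.Formula (Fin n)), T₀ ⊆ T → T₀.Finite → SatisfiableIn B T₀

/-- The absolutely free `L`-algebra: terms with the syntactic operations. -/
instance termStructure [L.IsAlgebraic] (α : Type w) : L.Structure (L.Term α) where
  funMap f ts := Term.func f ts
  RelMap r := isEmptyElim r

/-- The congruence `t ∼ s ↔ (t = s) ∈ Rad(Y)` on the algebra of terms. -/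
@[reducible]
def radSetoid (Y : Set (Fin n → B)) : Setoid (L.Term (Fin n)) where
  r t s := (t, s) ∈ radSet B Y
  iseqv :=
    { refl := fun _ _ => fun _ => rfl
      symm := fun h b hb => (h hb).symm
      trans := fun h h' b hb => (h hb).trans (h' hb) }

instance radPrestructure [L.IsAlgebraic] (Y : Set (Fin n → B)) :
    L.Prestructure (radSetoid B Y) where
  toStructure := termStructure (Fin n)
  fun_equiv {m} f x y h := by
    intro b hb
    change (Term.func f x).realize b = (Term.func f y).realize b
    rw [Term.realize_func, Term.realize_func]
    exact congrArg _ (funext fun i => h i hb)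
  rel_equiv {m} r := isEmptyElim r

/-- The coordinate algebra `Γ(Y)`, the quotient of the algebra of terms in `x_1, …, x_n` by the
congruence of `Rad(Y)`. Its `L`-structure is the quotient structure. -/
abbrev CoordAlg (Y : Set (Fin n → B)) : Type u := Quotient (radSetoid B Y)

/-- `C` is isomorphic to the coordinate algebra of some algebraic set over `B`. -/
def IsCoordinateAlgebra [L.IsAlgebraic] (C : Alg.{u, v, w} L) : Prop :=
  ∃ (n : ℕ) (Y : Set (Fin n → B)), IsAlgebraicSet B Y ∧ Nonempty (C ≃[L] CoordAlg B Y)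

end Geometry

section DirectLimits

/-- A direct system of algebras over a nonempty directed partially ordered set. -/
structure DirectSystem (L : FirstOrder.Language.{u, v}) : Type (max u v (c + 1)) where
  I : Type c
  [po : PartialOrder I]
  [dir : IsDirectedOrder I]
  [ne : Nonempty I]
  obj : I → Alg.{u, v, c} L
  map : ∀ {i j : I}, i ≤ j → (obj i →[L] obj j)
  map_id : ∀ (i : I) (x : obj i), map (le_refl i) x = x
  map_map : ∀ {i j k : I} (hij : i ≤ j) (hjk : j ≤ k) (x : obj i),
    map hjk (map hij x) = map (hij.trans hjk) x

namespace DirectSystem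

variable {L : FirstOrder.Language.{u, v}} (D : DirectSystem.{u, v, c} L)

instance : PartialOrder D.I := D.po
instance : IsDirectedOrder D.I := D.dir
instance : Nonempty D.I := D.ne

/-- All maps of the system are onto. -/
def IsEpimorphic : Prop := ∀ (i j : D.I) (h : i ≤ j), Function.Surjective (D.map h)

/-- Elements of the disjoint union are identified when they become equal further on. -/
@[reducible]
def setoid : Setoid (Σ i, D.obj i) where
  r x y := ∃ (k : D.I) (hx : x.1 ≤ k) (hy : y.1 ≤ k), D.map hx x.2 = D.map hy y.2
  iseqv :=
    { refl := fun x => ⟨x.1, le_rfl, le_rfl, rfl⟩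
      symm := fun ⟨k, hx, hy, h⟩ => ⟨k, hy, hx, h.symm⟩
      trans := by
        rintro x y z ⟨k, hx, hy, h⟩ ⟨l, hy', hz, h'⟩
        obtain ⟨m, hk, hl⟩ := exists_ge_ge k l
        refine ⟨m, hx.trans hk, hz.trans hl, ?_⟩
        rw [← D.map_map hx hk, h, D.map_map, ← D.map_map hz hl, ← h', D.map_map] }

theorem exists_bound {m : ℕ} (x : Fin m → Σ i, D.obj i) : ∃ i : D.I, ∀ k, (x k).1 ≤ i := by
  obtain ⟨i, hi⟩ := Finite.bddAbove_range fun k => (x k).1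
  exact ⟨i, fun k => hi ⟨k, rfl⟩⟩

/-- An index above the indices of all the entries of a tuple. -/
noncomputable def bound {m : ℕ} (x : Fin m → Σ i, D.obj i) : D.I :=
  Classical.choose (D.exists_bound x)

theorem le_bound {m : ℕ} (x : Fin m → Σ i, D.obj i) (k : Fin m) : (x k).1 ≤ D.bound x :=
  Classical.choose_spec (D.exists_bound x) k

/-- Operations on the direct limit: move the arguments to one algebra of the system and apply
the operation there (see `limit_funMap_mk` for the independence of the choices). -/
noncomputable instance limitStructure [L.IsAlgebraic] : L.Structure (Quotient D.setoid) where
  funMap f x :=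
    Quotient.mk D.setoid
      ⟨D.bound fun k => (x k).out,
        Structure.funMap f fun k => D.map (D.le_bound (fun k => (x k).out) k) (x k).out.2⟩
  RelMap r := isEmptyElim r

/-- The direct limit of the system. -/
noncomputable def limit [L.IsAlgebraic] : Alg.{u, v, c} L where
  Carrier := Quotient D.setoid
  nonempty := by
    obtain ⟨i⟩ := D.ne
    obtain ⟨x⟩ := (D.obj i).nonempty
    exact ⟨Quotient.mk _ ⟨i, x⟩⟩

theorem limit_funMap_mk [L.IsAlgebraic] {m : ℕ} (f : L.Functions m) (i : D.I)
    (x : Fin m → D.obj i) :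
    Structure.funMap f (fun k => (Quotient.mk D.setoid ⟨i, x k⟩ : Quotient D.setoid)) =
      Quotient.mk D.setoid ⟨i, Structure.funMap f x⟩ := by
  set y : Fin m → Quotient D.setoid := fun k => Quotient.mk D.setoid ⟨i, x k⟩ with hy
  have h : ∀ k, D.setoid.r (y k).out ⟨i, x k⟩ := fun k => Quotient.exact (Quotient.out_eq (y k))
  choose l hl hi e using h
  obtain ⟨t, ht⟩ := Finite.bddAbove_range l
  obtain ⟨s, hs, hbs⟩ := exists_ge_ge t (D.bound fun k => (y k).out)
  have hls : ∀ k, l k ≤ s := fun k => (ht ⟨k, rfl⟩).trans hs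
  obtain ⟨r, his, hsr⟩ := exists_ge_ge i s
  refine Quotient.sound ⟨r, hbs.trans hsr, his, ?_⟩
  rw [Hom.map_fun, Hom.map_fun]
  congr 1
  funext k
  have hk := congrArg (D.map ((hls k).trans hsr)) (e k)
  simp only [D.map_map] at hk
  simp only [Function.comp_apply, D.map_map]
  exact hk

/-- The canonical homomorphisms into the direct limit. -/
noncomputable def toLimit [L.IsAlgebraic] (i : D.I) : D.obj i →[L] D.limit where
  toFun x := Quotient.mk D.setoid ⟨i, x⟩
  map_fun' f x := (D.limit_funMap_mk f i x).symm
  map_rel' r := isEmptyElim r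

theorem toLimit_eq_iff [L.IsAlgebraic] (i : D.I) (x y : D.obj i) :
    D.toLimit i x = D.toLimit i y ↔ ∃ (j : D.I) (h : i ≤ j), D.map h x = D.map h y :=
  ⟨fun h => by
    obtain ⟨k, hx, _, e⟩ := Quotient.exact h
    exact ⟨k, hx, e⟩, fun ⟨j, h, e⟩ => Quotient.sound ⟨j, h, h, e⟩⟩

theorem toLimit_map [L.IsAlgebraic] {i j : D.I} (h : i ≤ j) (x : D.obj i) :
    D.toLimit j (D.map h x) = D.toLimit i x :=
  Quotient.sound ⟨j, le_rfl, h, D.map_id j _⟩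

theorem exists_toLimit [L.IsAlgebraic] (a : D.limit) : ∃ (i : D.I) (x : D.obj i),
    D.toLimit i x = a := by
  obtain ⟨⟨i, x⟩, rfl⟩ := Quotient.exists_rep a
  exact ⟨i, x, rfl⟩

end DirectSystem

end DirectLimits

section Operators

variable {L : FirstOrder.Language.{u, v}}

/-- The direct product of a family of algebras; the empty product is the trivial algebra. -/
def Alg.pi {I : Type c} (A : I → Alg.{u, v, c} L) : Alg.{u, v, c} L where
  Carrier := ∀ i, A i
  str :=
    { funMap := fun f x i => Structure.funMap f fun k => x k i
      RelMap := fun r x => ∀ i, Structure.RelMap r fun k => x k i }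
  nonempty := inferInstance

/-- `S(K)`: algebras isomorphic to a subalgebra of an algebra from `K`. -/
def opS (K : Set (Alg.{u, v, c} L)) : Set (Alg.{u, v, c} L) :=
  {C | ∃ A ∈ K, Nonempty (C ↪[L] A)}

/-- `P(K)`: algebras isomorphic to a direct product of algebras from `K`, the empty product
included. -/
def opP (K : Set (Alg.{u, v, c} L)) : Set (Alg.{u, v, c} L) :=
  {C | ∃ (I : Type c) (A : I → Alg.{u, v, c} L), (∀ i, A i ∈ K) ∧ Nonempty (C ≃[L] Alg.pi A)}

/-- Algebras isomorphic to a direct limit of algebras from `K`. -/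
def opL [L.IsAlgebraic] (K : Set (Alg.{u, v, c} L)) : Set (Alg.{u, v, c} L) :=
  {C | ∃ D : DirectSystem.{u, v, c} L, (∀ i, D.obj i ∈ K) ∧ Nonempty (C ≃[L] D.limit)}

/-- Algebras isomorphic to an epimorphic direct limit of algebras from `K`. -/
def opLs [L.IsAlgebraic] (K : Set (Alg.{u, v, c} L)) : Set (Alg.{u, v, c} L) :=
  {C | ∃ D : DirectSystem.{u, v, c} L, D.IsEpimorphic ∧ (∀ i, D.obj i ∈ K) ∧
    Nonempty (C ≃[L] D.limit)}

/-- `L_fg(K)`: algebras all of whose finitely generated subalgebras are in `K`. Subalgebras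
are nonempty, as all algebras are. -/
def opLfg (K : Set (Alg.{u, v, c} L)) : Set (Alg.{u, v, c} L) :=
  {C | ∀ (N : L.Substructure C) (_ : Nonempty N), N.FG → (⟨N⟩ : Alg.{u, v, c} L) ∈ K}

/-- `Res(K)`: algebras separated by `K`. -/
def Res (K : Set (Alg.{u, v, c} L)) : Set (Alg.{u, v, c} L) :=
  {C | ∀ x y : C, x ≠ y → ∃ A ∈ K, ∃ h : C →[L] A, h x ≠ h y}

/-- A prevariety is a class closed under subalgebras and direct products
(and thus under isomorphism). -/
def IsPrevariety (K : Set (Alg.{u, v, c} L)) : Prop := opS K ⊆ K ∧ opP K ⊆ K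

/-- `Pvar(K)`: the least prevariety that includes `K`. -/
def Pvar (K : Set (Alg.{u, v, c} L)) : Set (Alg.{u, v, c} L) :=
  ⋂₀ {K' | IsPrevariety K' ∧ K ⊆ K'}

/-- The quasi-identities that are true in all algebras from `K`. -/
def ThQI (K : Set (Alg.{u, v, c} L)) : Set L.Sentence :=
  {φ | IsQuasiIdentity φ ∧ ∀ A ∈ K, Sentence.Realize A φ}

/-- `Qvar(K)`: the models of all quasi-identities that are true in `K`. -/
def Qvar (K : Set (Alg.{u, v, c} L)) : Set (Alg.{u, v, c} L) :=
  {C | ∀ φ ∈ ThQI K, Sentence.Realize C φ}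

/-- `K_ω`: the finitely generated algebras from `K`. -/
def fgPart (K : Set (Alg.{u, v, c} L)) : Set (Alg.{u, v, c} L) :=
  {C | C ∈ K ∧ Structure.FG L C}

end Operators

end UAG

/-! Everything is reduced to two notions: finitary radicals (`RadFinitary`) on the syntactic side,
and the class `Res {B}` on the algebraic side. For one algebra B, separation by homomorphisms into B
amounts to embedding in a power of B, so SP(B) = Pvar(B) = Res(B), and the coordinate algebras are
exactly the finitely generated members of Res(B) (`isCoordinateAlgebra_iff`). With no compactness
assumption, both limit operators applied to Res(B) give Qvar(B): quasi-identities have finitely many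
premises, so they survive direct limits (`opL_Qvar_subset`), and an algebra of Qvar(B) is the limit
of the images in powers of B determined by finite parts of its positive diagram
(`Qvar_subset_opLs`). The algebraic conditions thus all say that the finitely generated algebras of
Qvar(B) lie in Res(B).

Finitary radicals give this: if generators of C satisfy exactly the equations S, then an equation in
Rad(S) follows over B from a finite part of S, hence holds in C by a quasi-identity; so distinct
elements of C are separated at a point of V(S), that is, by a homomorphism into B
(`RadFinitary.isCoordinateAlgebra`). Conversely, the coordinate algebras of V(F), for F finite in S,
have as limit the term algebra modulo the union of the Rad(F). If B separates this limit, that union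
contains Rad(S) (`radFinitary_of_limits`). The condition on unions of radical ideals is treated in
the same way, without passing to quotients. -/

namespace UAG

open FirstOrder FirstOrder.Language

/-! ### Terms, evaluation homomorphisms and quotients of term algebras -/

section Terms

variable {L : FirstOrder.Language.{u, v}}

theorem realize_quasiIdentity {M : Type*} [L.Structure M] [Nonempty M] {n : ℕ}
    (S : Finset (Eqn L n)) (e : Eqn L n) :
    Sentence.Realize M (quasiIdentity S e) ↔
      ∀ b : Fin n → M, (∀ p ∈ S, p.1.realize b = p.2.realize b) →
        e.1.realize b = e.2.realize b := by
  unfold quasiIdentity Sentence.Realize Formula.Realize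
  rw [BoundedFormula.realize_iAlls]
  refine forall_congr' fun b => ?_
  rw [Formula.realize_relabel, Formula.realize_imp, Formula.iInf, Formula.Realize,
    BoundedFormula.realize_iInf]
  have h : (fun a => Sum.elim (default : Empty → M) b a) ∘ Sum.inr = b := rfl
  rw [h]
  refine imp_congr ?_ Formula.realize_equal
  exact Subtype.forall.trans
    (forall_congr' fun p => forall_congr' fun _ => Formula.realize_equal)

/-- Only finitely many variables occur in a term. The finite set is chosen before the structure, so
one choice serves all algebras of a class and the algebra to be tested. -/
theorem exists_finset_realize_eq {α : Type w} (t : L.Term α) :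
    ∃ V : Finset α, ∀ {M : Type c} [L.Structure M] (a b : α → M), (∀ x ∈ V, a x = b x) →
      t.realize a = t.realize b := by
  classical
  induction t with
  | var x => exact ⟨{x}, fun a b h => h x (Finset.mem_singleton_self x)⟩
  | func f ts ih =>
    choose V hV using ih
    refine ⟨Finset.univ.biUnion V, fun a b h => ?_⟩
    simp only [Term.realize_func]
    exact congrArg _ (funext fun i => hV i a b fun x hx =>
      h x (Finset.mem_biUnion.2 ⟨i, Finset.mem_univ i, hx⟩))

variable [L.IsAlgebraic]

/-- The homomorphism from the term algebra that extends an assignment of the variables. -/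
def evalHom {α : Type w} {M : Type c} [L.Structure M] (b : α → M) : L.Term α →[L] M where
  toFun t := t.realize b
  map_fun' f x := Term.realize_func b f x
  map_rel' r := isEmptyElim r

@[simp]
theorem evalHom_apply {α : Type w} {M : Type c} [L.Structure M] (b : α → M) (t : L.Term α) :
    evalHom b t = t.realize b := rfl

theorem realize_var_eq {α : Type w} (t : L.Term α) :
    t.realize (Term.var : α → L.Term α) = t := by
  induction t with
  | var x => rfl
  | func f ts ih =>
    rw [Term.realize_func]
    exact congrArg (Term.func f) (funext ih)

theorem hom_eq_realize {α : Type w} {M : Type c} [L.Structure M] (h : L.Term α →[L] M)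
    (t : L.Term α) : h t = t.realize (h ∘ Term.var) := by
  rw [HomClass.realize_term h, realize_var_eq]

/-- The values of terms at `b` form the generated substructure. This presents a finitely generated
algebra as a quotient of a term algebra in finitely many variables. -/
theorem surjective_evalHom_iff {α : Type w} {M : Type c} [L.Structure M] (b : α → M) :
    Function.Surjective (evalHom (L := L) b) ↔ Substructure.closure L (Set.range b) = ⊤ := by
  rw [eq_top_iff]
  constructor
  · intro h y _
    obtain ⟨t, rfl⟩ := h y
    rw [evalHom_apply]
    exact t.realize_mem _ (fun x => Substructure.subset_closure ⟨x, rfl⟩)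
  · intro h y
    have hle : Substructure.closure L (Set.range b) ≤ (evalHom (L := L) b).range := by
      rw [Substructure.closure_le]
      rintro _ ⟨x, rfl⟩
      exact ⟨Term.var x, rfl⟩
    exact hle (h (Substructure.mem_top y))

/-- A homomorphism factors through a surjective one whose kernel is smaller. -/
theorem exists_factor {T : Type*} {M : Type*} {N : Type*} [L.Structure T] [L.Structure M]
    [L.Structure N] (f : T →[L] M) (hf : Function.Surjective f) (g : T →[L] N)
    (h : ∀ t s, f t = f s → g t = g s) : ∃ k : M →[L] N, ∀ t, k (f t) = g t := by
  obtain ⟨r, hr⟩ := hf.hasRightInverse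
  have hk : ∀ t, g (r (f t)) = g t := fun t => h _ _ (hr _)
  refine ⟨⟨fun m => g (r m), fun {n} F x => ?_, fun R => isEmptyElim R⟩, hk⟩
  have hx : x = f ∘ fun i => r (x i) := funext fun i => (hr (x i)).symm
  have h' : g (r (Structure.funMap F x)) = Structure.funMap F (g ∘ fun i => r (x i)) := by
    conv_lhs => rw [hx]
    rw [← Hom.map_fun, hk, Hom.map_fun]
  exact h'

theorem nonempty_equiv_of_ker_eq {T : Type*} {M : Type*} {N : Type*} [L.Structure T]
    [L.Structure M] [L.Structure N] (f : T →[L] M) (hf : Function.Surjective f) (g : T →[L] N)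
    (hg : Function.Surjective g) (h : ∀ t s, f t = f s ↔ g t = g s) : Nonempty (M ≃[L] N) := by
  obtain ⟨k, hk⟩ := exists_factor f hf g fun t s => (h t s).1
  obtain ⟨l, hl⟩ := exists_factor g hg f fun t s => (h t s).2
  exact ⟨{ toFun := k
           invFun := l
           left_inv := fun m => by obtain ⟨t, rfl⟩ := hf m; rw [hk, hl]
           right_inv := fun m => by obtain ⟨t, rfl⟩ := hg m; rw [hl, hk]
           map_fun' := k.map_fun'
           map_rel' := fun R => isEmptyElim R }⟩

end Terms

/-! ### Quasivarieties, prevarieties and separation by homomorphisms -/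

section Classes

variable {L : FirstOrder.Language.{u, v}}

theorem mem_Qvar_iff {K : Set (Alg.{u, v, c} L)} {C : Alg.{u, v, c} L} :
    C ∈ Qvar K ↔ ∀ (n : ℕ) (S : Finset (Eqn L n)) (e : Eqn L n),
      (∀ A ∈ K, ∀ b : Fin n → A, (∀ p ∈ S, p.1.realize b = p.2.realize b) →
        e.1.realize b = e.2.realize b) →
      ∀ b : Fin n → C, (∀ p ∈ S, p.1.realize b = p.2.realize b) →
        e.1.realize b = e.2.realize b := by
  constructor
  · intro hC n S e h
    exact (realize_quasiIdentity S e).1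
      (hC _ ⟨⟨n, S, e, rfl⟩, fun A hA => (realize_quasiIdentity S e).2 (h A hA)⟩)
  · rintro h φ ⟨⟨n, S, e, rfl⟩, hφ⟩
    exact (realize_quasiIdentity S e).2
      (h n S e fun A hA => (realize_quasiIdentity S e).1 (hφ A hA))

/-- Implications between equations in any set of variables, with finitely many premises,
pass from `K` to `Qvar K`. -/
theorem realize_eq_of_mem_Qvar {K : Set (Alg.{u, v, c} L)} {C : Alg.{u, v, c} L}
    (hC : C ∈ Qvar K) {α : Type w} (F : Finset (L.Term α × L.Term α)) (e : L.Term α × L.Term α)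
    (h : ∀ A ∈ K, ∀ b : α → A, (∀ p ∈ F, p.1.realize b = p.2.realize b) →
      e.1.realize b = e.2.realize b)
    (a : α → C) (ha : ∀ p ∈ F, p.1.realize a = p.2.realize a) :
    e.1.realize a = e.2.realize a := by
  classical
  choose V hV using fun t : L.Term α => exists_finset_realize_eq.{u, v, w, c} t
  let W : Finset α := (insert e F).biUnion fun p => V p.1 ∪ V p.2
  have hW : ∀ p ∈ insert e F, V p.1 ⊆ W ∧ V p.2 ⊆ W := fun p hp =>
    ⟨fun x hx => Finset.mem_biUnion.2 ⟨p, hp, Finset.mem_union_left _ hx⟩,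
      fun x hx => Finset.mem_biUnion.2 ⟨p, hp, Finset.mem_union_right _ hx⟩⟩
  -- The extra point `none` receives every variable outside `W`, so that the renaming `g` is total;
  -- its value in `C` is arbitrary.
  obtain ⟨n, ⟨E⟩⟩ := Finite.exists_equiv_fin (Option W)
  let g : α → Fin n := fun x => E (if hx : x ∈ W then some ⟨x, hx⟩ else none)
  let z : C := Classical.arbitrary C
  let a' : Fin n → C := fun k => (E.symm k).elim z fun x => a x
  have hag : ∀ x ∈ W, (a' ∘ g) x = a x := fun x hx => by simp [a', g, hx]
  have key : ∀ p ∈ insert e F, p.1.realize (a' ∘ g) = p.1.realize a ∧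
      p.2.realize (a' ∘ g) = p.2.realize a := fun p hp =>
    ⟨hV p.1 _ _ fun x hx => hag x ((hW p hp).1 hx), hV p.2 _ _ fun x hx => hag x ((hW p hp).2 hx)⟩
  have hfin := mem_Qvar_iff.1 hC n (F.image fun p => (p.1.relabel g, p.2.relabel g))
    (e.1.relabel g, e.2.relabel g) (fun A hA b hb => by
      simp only [Term.realize_relabel]
      refine h A hA _ fun p hp => ?_
      have := hb _ (Finset.mem_image_of_mem _ hp)
      simpa only [Term.realize_relabel] using this) a' (fun p hp => by
      obtain ⟨q, hq, rfl⟩ := Finset.mem_image.1 hp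
      simp only [Term.realize_relabel]
      rw [(key q (Finset.mem_insert_of_mem hq)).1, (key q (Finset.mem_insert_of_mem hq)).2]
      exact ha q hq)
  simp only [Term.realize_relabel] at hfin
  rwa [(key e (Finset.mem_insert_self e F)).1, (key e (Finset.mem_insert_self e F)).2] at hfin

/-- A homomorphism preserves the premises, and one that separates the two sides of a failing
conclusion would carry the failure into an algebra of `K`. -/
theorem Res_subset_Qvar (K : Set (Alg.{u, v, c} L)) : Res K ⊆ Qvar K := by
  intro C hC
  refine mem_Qvar_iff.2 fun n S e h b hb => ?_
  by_contra hne
  obtain ⟨A, hA, k, hk⟩ := hC _ _ hne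
  rw [← HomClass.realize_term k, ← HomClass.realize_term k] at hk
  refine hk (h A hA _ fun p hp => ?_)
  rw [HomClass.realize_term k, HomClass.realize_term k, hb p hp]

theorem Qvar_of_embedding {K : Set (Alg.{u, v, c} L)} {C D : Alg.{u, v, c} L} (f : D ↪[L] C)
    (hC : C ∈ Qvar K) : D ∈ Qvar K := by
  refine mem_Qvar_iff.2 fun n S e h b hb => f.injective ?_
  rw [← HomClass.realize_term f, ← HomClass.realize_term f]
  refine mem_Qvar_iff.1 hC n S e h _ fun p hp => ?_
  rw [HomClass.realize_term f, HomClass.realize_term f, hb p hp]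

theorem Res_of_injective {K : Set (Alg.{u, v, c} L)} {C D : Alg.{u, v, c} L} (f : D →[L] C)
    (hf : Function.Injective f) (hC : C ∈ Res K) : D ∈ Res K := by
  intro x y hxy
  obtain ⟨A, hA, h, hne⟩ := hC _ _ (hf.ne hxy)
  exact ⟨A, hA, h.comp f, hne⟩

theorem subset_Res (K : Set (Alg.{u, v, c} L)) : K ⊆ Res K :=
  fun A hA _ _ hxy => ⟨A, hA, Hom.id L A, hxy⟩

/-- The coordinate projections of a product. -/
def Alg.proj {I : Type c} (A : I → Alg.{u, v, c} L) (i : I) : Alg.pi A →[L] A i where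
  toFun x := x i
  map_fun' _ _ := rfl
  map_rel' _ _ h := h i

theorem pi_mem_Res {K : Set (Alg.{u, v, c} L)} {I : Type c} (A : I → Alg.{u, v, c} L)
    (hA : ∀ i, A i ∈ Res K) : Alg.pi A ∈ Res K := by
  intro x y hxy
  obtain ⟨i, hi⟩ := Function.ne_iff.1 hxy
  obtain ⟨D, hD, h, hne⟩ := hA i _ _ hi
  exact ⟨D, hD, h.comp (Alg.proj A i), hne⟩

theorem isPrevariety_Res (K : Set (Alg.{u, v, c} L)) : IsPrevariety (Res K) := by
  constructor
  · rintro C ⟨A, hA, ⟨f⟩⟩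
    exact Res_of_injective f.toHom f.injective hA
  · rintro C ⟨I, A, hA, ⟨f⟩⟩
    exact Res_of_injective f.toHom f.injective (pi_mem_Res A hA)

theorem opS_mono {K K' : Set (Alg.{u, v, c} L)} (h : K ⊆ K') : opS K ⊆ opS K' :=
  fun _ ⟨A, hA, f⟩ => ⟨A, h hA, f⟩

theorem opP_mono {K K' : Set (Alg.{u, v, c} L)} (h : K ⊆ K') : opP K ⊆ opP K' :=
  fun _ ⟨I, A, hA, f⟩ => ⟨I, A, fun i => h (hA i), f⟩

theorem IsPrevariety.opS_opP_subset {K K' : Set (Alg.{u, v, c} L)} (hK' : IsPrevariety K')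
    (h : K ⊆ K') : opS (opP K) ⊆ K' :=
  (opS_mono ((opP_mono h).trans hK'.2)).trans hK'.1

/-- A quasi-identity that fails does so at a finite tuple, hence already in the subalgebra generated
by that tuple. -/
theorem opLfg_subset_Qvar (K : Set (Alg.{u, v, c} L)) : opLfg (Qvar K) ⊆ Qvar K := by
  intro C hC
  refine mem_Qvar_iff.2 fun n S e h b hb => ?_
  let N := Substructure.closure L (Set.range b)
  have hbN : ∀ k, b k ∈ N := fun k => Substructure.subset_closure ⟨k, rfl⟩
  -- The tuple may be empty, so the element of `N` is taken to be the value of a term.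
  have hN : Nonempty N := ⟨⟨_, e.1.realize_mem b hbN⟩⟩
  have hQ := hC N hN (Substructure.fg_closure (Set.finite_range b))
  let b' : Fin n → N := fun k => ⟨b k, hbN k⟩
  have hb' : ∀ t : L.Term (Fin n), ((t.realize b' : N) : C) = t.realize b := fun t =>
    (HomClass.realize_term N.subtype (t := t) (v := b')).symm
  have := mem_Qvar_iff.1 hQ n S e h b' fun p hp => Subtype.ext (by
    rw [hb', hb']; exact hb p hp)
  rw [← hb', ← hb']
  exact congrArg _ this

theorem opLfg_mono {K K' : Set (Alg.{u, v, c} L)} (h : K ⊆ K') : opLfg K ⊆ opLfg K' :=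
  fun _ hC N hN hfg => h (hC N hN hfg)

/-- `Qvar` is hereditary and determined by finitely generated subalgebras, and `Res` lies inside it;
the only content on either side is that finitely generated algebras of `Qvar {B}` are separated by
`B`. -/
theorem fgPart_Qvar_eq_iff (B : Alg.{u, v, c} L) :
    fgPart (Qvar {B}) = fgPart (Res {B}) ↔ Qvar {B} = opLfg (Res {B}) := by
  constructor
  · intro h
    refine Set.Subset.antisymm (fun C hC N hN hfg => ?_)
      ((opLfg_mono (Res_subset_Qvar _)).trans (opLfg_subset_Qvar _))
    have hmem : (⟨N⟩ : Alg.{u, v, c} L) ∈ fgPart (Qvar {B}) :=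
      ⟨Qvar_of_embedding N.subtype hC, (Substructure.fg_iff_structure_fg N).1 hfg⟩
    rw [h] at hmem
    exact hmem.1
  · intro h
    refine Set.Subset.antisymm (fun C hC => ⟨?_, hC.2⟩)
      fun C hC => ⟨Res_subset_Qvar _ hC.1, hC.2⟩
    have hL := hC.1
    rw [h] at hL
    have hne : Nonempty (⊤ : L.Substructure C) := ⟨⟨Classical.arbitrary C, trivial⟩⟩
    exact Res_of_injective (D := C) (C := ⟨(⊤ : L.Substructure C)⟩)
      Substructure.topEquiv.symm.toHom Substructure.topEquiv.symm.injective
      (hL ⊤ hne (Structure.fg_def.1 hC.2))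

variable [L.IsAlgebraic]

/-- Evaluation at all homomorphisms `C →[L] B` maps `C` into a power of `B`, and separation is its
injectivity. The power may be empty; then `C` is trivial. -/
theorem Res_singleton_subset_opS_opP (B : Alg.{u, v, c} L) : Res {B} ⊆ opS (opP {B}) := by
  intro C hC
  refine ⟨Alg.pi fun _ : C →[L] B => B, ⟨_, _, fun _ => rfl, ⟨.refl L _⟩⟩,
    ⟨⟨⟨fun x h => h x, fun x y hxy => ?_⟩, fun F x => ?_, fun R => isEmptyElim R⟩⟩⟩
  · by_contra hne
    obtain ⟨A, rfl, h, hh⟩ := hC x y hne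
    exact hh (congrFun hxy h)
  · exact funext fun h => h.map_fun F x

theorem opS_opP_singleton (B : Alg.{u, v, c} L) : opS (opP {B}) = Res {B} :=
  ((isPrevariety_Res _).opS_opP_subset (subset_Res _)).antisymm (Res_singleton_subset_opS_opP B)

theorem Pvar_singleton (B : Alg.{u, v, c} L) : Pvar {B} = Res {B} := by
  apply Set.Subset.antisymm
  · exact Set.sInter_subset_of_mem ⟨isPrevariety_Res _, subset_Res _⟩
  · rw [← opS_opP_singleton]
    exact Set.subset_sInter fun K' hK' => hK'.1.opS_opP_subset hK'.2

/-- Quasivarieties are closed under direct limits. -/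
theorem opL_Qvar_subset (K : Set (Alg.{u, v, c} L)) : opL (Qvar K) ⊆ Qvar K := by
  rintro C ⟨D, hD, ⟨f⟩⟩
  refine Qvar_of_embedding f.toEmbedding (mem_Qvar_iff.2 fun n S e h b hb => ?_)
  classical
  choose l y hy using fun k => D.exists_toLimit (b k)
  obtain ⟨i, hi⟩ := Finite.bddAbove_range l
  let b' : Fin n → D.obj i := fun k => D.map (hi ⟨k, rfl⟩) (y k)
  have hbb : D.toLimit i ∘ b' = b := funext fun k => (D.toLimit_map _ _).trans (hy k)
  -- A premise that holds in the limit holds at some later stage; since the premises are finitely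
  -- many, one stage `r` serves them all.
  have hmap : ∀ p ∈ S, ∃ j : D.I, ∃ hij : i ≤ j,
      D.map hij (p.1.realize b') = D.map hij (p.2.realize b') := fun p hp => by
    rw [← D.toLimit_eq_iff, ← HomClass.realize_term (D.toLimit i),
      ← HomClass.realize_term (D.toLimit i), hbb]
    exact hb p hp
  choose j hij he using fun p : S => hmap p.1 p.2
  obtain ⟨m, hm⟩ := Finite.bddAbove_range j
  obtain ⟨r, hmr, hir⟩ := exists_ge_ge m i
  have hr := mem_Qvar_iff.1 (hD r) n S e h (D.map hir ∘ b') fun p hp => by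
    have hjr : j ⟨p, hp⟩ ≤ r := (hm ⟨⟨p, hp⟩, rfl⟩).trans hmr
    have := congrArg (D.map hjr) (he ⟨p, hp⟩)
    rw [HomClass.realize_term (D.map hir), HomClass.realize_term (D.map hir)]
    simpa only [D.map_map] using this
  have hrb : D.toLimit r ∘ D.map hir ∘ b' = b := by
    rw [← hbb]
    exact funext fun k => D.toLimit_map _ _
  have := congrArg (D.toLimit r) hr
  rwa [← HomClass.realize_term (D.toLimit r), ← HomClass.realize_term (D.toLimit r), hrb] at this

theorem opL_mono {K K' : Set (Alg.{u, v, c} L)} (h : K ⊆ K') : opL K ⊆ opL K' :=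
  fun _ ⟨D, hD, f⟩ => ⟨D, fun i => h (hD i), f⟩

theorem opLs_subset_opL (K : Set (Alg.{u, v, c} L)) : opLs K ⊆ opL K :=
  fun _ ⟨D, _, hD, f⟩ => ⟨D, hD, f⟩

end Classes

/-! ### Finitary radicals and the syntactic conditions -/

section Radicals

variable {L : FirstOrder.Language.{u, v}}

theorem subset_rad (B : Alg.{u, v, c} L) {n : ℕ} (S : Set (Eqn L n)) : S ⊆ rad B S :=
  fun _ he _ hb => hb _ he

theorem rad_mono (B : Alg.{u, v, c} L) {n : ℕ} {S S' : Set (Eqn L n)} (h : S ⊆ S') :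
    rad B S ⊆ rad B S' :=
  fun _ he _ hb => he fun p hp => hb p (h hp)

theorem solSet_rad (B : Alg.{u, v, c} L) {n : ℕ} (S : Set (Eqn L n)) :
    solSet B (rad B S) = solSet B S := (rad_isGreatest B S).1

theorem rad_rad (B : Alg.{u, v, c} L) {n : ℕ} (S : Set (Eqn L n)) : rad B (rad B S) = rad B S :=
  congrArg (radSet B) (solSet_rad B S)

/-- Every consequence over `B` of a system follows from a finite subsystem. -/
def RadFinitary (B : Alg.{u, v, c} L) : Prop :=
  ∀ (n : ℕ) (S : Set (Eqn L n)) (e : Eqn L n), e ∈ rad B S →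
    ∃ Sc : Set (Eqn L n), Sc ⊆ S ∧ Sc.Finite ∧ e ∈ rad B Sc

/-- A finite system of equations inside a directed union lies in one member, which already contains
all consequences of that system. -/
theorem RadFinitary.isRadicalIdeal_iUnion {B : Alg.{u, v, c} L} (h : RadFinitary B) {n : ℕ}
    {I : Type w} [PartialOrder I] [IsDirectedOrder I] [Nonempty I] (S : I → Set (Eqn L n))
    (hS : ∀ i, IsRadicalIdeal B (S i)) (hmono : Monotone S) : IsRadicalIdeal B (⋃ i, S i) := by
  refine (subset_rad B _).antisymm fun e he => ?_
  obtain ⟨F, hF, hFf, hmem⟩ := h n _ e he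
  lift F to Finset (Eqn L n) using hFf
  obtain ⟨i, hi⟩ := hmono.directed_le.exists_mem_subset_of_finset_subset_biUnion hF
  refine Set.mem_iUnion.2 ⟨i, ?_⟩
  rw [hS i]
  exact rad_mono B hi hmem

theorem isQOmegaCompact_iff (B : Alg.{u, v, c} L) : IsQOmegaCompact B ↔ RadFinitary B :=
  forall₃_congr fun _ _ _ => imp_congr Iff.rfl (exists_congr fun _ =>
    ⟨fun ⟨h, hf, _, he⟩ => ⟨h, hf, he⟩, fun ⟨h, hf, he⟩ =>
      ⟨h, hf, fun _ hb p hp => hb p (h hp), he⟩⟩)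

theorem holdsInfQuasiIdentity_iff (B : Alg.{u, v, c} L) {n : ℕ} (S : Set (Eqn L n))
    (e : Eqn L n) : HoldsInfQuasiIdentity B S e ↔ e ∈ rad B S :=
  forall_congr' fun _ => imp_congr
    (forall₂_congr fun _ _ => Formula.realize_equal) Formula.realize_equal

theorem realize_quasiIdentity_iff_mem_rad (B : Alg.{u, v, c} L) {n : ℕ} (S : Finset (Eqn L n))
    (e : Eqn L n) : Sentence.Realize B (quasiIdentity S e) ↔ e ∈ rad B (S : Set (Eqn L n)) :=
  realize_quasiIdentity S e

theorem radFinitary_iff_quasiIdentity (B : Alg.{u, v, c} L) : RadFinitary B ↔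
    ∀ (n : ℕ) (S : Set (Eqn L n)) (e : Eqn L n), HoldsInfQuasiIdentity B S e →
      ∃ Sc : Finset (Eqn L n), (Sc : Set (Eqn L n)) ⊆ S ∧
        Sentence.Realize B (quasiIdentity Sc e) := by
  refine forall₃_congr fun n S e => imp_congr (holdsInfQuasiIdentity_iff B S e).symm ?_
  simp only [realize_quasiIdentity_iff_mem_rad]
  constructor
  · rintro ⟨F, hF, hFf, he⟩
    exact ⟨hFf.toFinset, by rwa [hFf.coe_toFinset], by rwa [hFf.coe_toFinset]⟩
  · rintro ⟨F, hF, he⟩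
    exact ⟨F, hF, F.finite_toSet, he⟩

theorem satisfiableIn_iff (B : Alg.{u, v, c} L) {n : ℕ} (S : Set (Eqn L n)) (e : Eqn L n) :
    SatisfiableIn B (Eqn.toFormula '' S ∪ {e.toFormula.not}) ↔ e ∉ rad B S := by
  have hnot : ∀ b : Fin n → B, e.toFormula.not.Realize b ↔ ¬ e.1.realize b = e.2.realize b :=
    fun b => Formula.realize_not.trans (not_congr Formula.realize_equal)
  refine Iff.trans ?_ Set.not_subset.symm
  refine exists_congr fun b => ⟨fun h => ⟨fun p hp => ?_, ?_⟩, ?_⟩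
  · exact Formula.realize_equal.1 (h _ (Or.inl ⟨p, hp, rfl⟩))
  · exact (hnot b).1 (h _ (Or.inr rfl))
  · rintro ⟨hb, he⟩ φ (⟨p, hp, rfl⟩ | rfl)
    · exact Formula.realize_equal.2 (hb p hp)
    · exact (hnot b).2 he

/-- Adding the negation to a finite subset only strengthens it, so it is enough to test finite parts
of `S` together with the negation. -/
theorem finitelySatisfiableIn_iff (B : Alg.{u, v, c} L) {n : ℕ} (S : Set (Eqn L n))
    (e : Eqn L n) :
    FinitelySatisfiableIn B (Eqn.toFormula '' S ∪ {e.toFormula.not}) ↔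
      ∀ F ⊆ S, F.Finite → e ∉ rad B F := by
  constructor
  · intro h F hF hFf
    rw [← satisfiableIn_iff]
    exact h _ (Set.union_subset_union_left _ (Set.image_mono hF))
      ((hFf.image _).union (Set.finite_singleton _))
  · intro h T hT hTf
    obtain ⟨F, hF, hFf, hTF⟩ : ∃ F ⊆ S, F.Finite ∧
        T ⊆ Eqn.toFormula '' F ∪ {e.toFormula.not} := by
      obtain ⟨F, hF, hFf, hE⟩ := Set.exists_subset_image_finite_and.1
        (⟨T ∩ Eqn.toFormula '' S, Set.inter_subset_right, hTf.inter_of_left _, rfl⟩ :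
          ∃ t ⊆ Eqn.toFormula '' S, t.Finite ∧ t = T ∩ Eqn.toFormula '' S)
      refine ⟨F, hF, hFf, fun φ hφ => (hT hφ).imp_left fun h' => ?_⟩
      rw [hE]
      exact ⟨hφ, h'⟩
    obtain ⟨b, hb⟩ := (satisfiableIn_iff B F e).2 (h F hF hFf)
    exact ⟨b, fun φ hφ => hb φ (hTF hφ)⟩

theorem radFinitary_iff_satisfiableIn (B : Alg.{u, v, c} L) : RadFinitary B ↔
    ∀ (n : ℕ) (S : Set (Eqn L n)) (e : Eqn L n),
      FinitelySatisfiableIn B (Eqn.toFormula '' S ∪ {e.toFormula.not}) →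
        SatisfiableIn B (Eqn.toFormula '' S ∪ {e.toFormula.not}) := by
  refine forall₃_congr fun n S e => ?_
  rw [finitelySatisfiableIn_iff, satisfiableIn_iff, ← not_imp_not]
  refine imp_congr ?_ Iff.rfl
  push Not
  exact Iff.rfl

theorem radFinitary_iff_rad_eq_iUnion (B : Alg.{u, v, c} L) : RadFinitary B ↔
    ∀ (n : ℕ) (S : Set (Eqn L n)),
      rad B S = ⋃ S₀ ∈ {S₀ : Set (Eqn L n) | S₀ ⊆ S ∧ S₀.Finite}, rad B S₀ := by
  refine forall₂_congr fun n S => ?_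
  constructor
  · intro h
    refine Set.Subset.antisymm (fun e he => ?_) (Set.iUnion₂_subset fun F hF => rad_mono B hF.1)
    obtain ⟨F, hF, hFf, hmem⟩ := h e he
    exact Set.mem_iUnion₂.2 ⟨F, ⟨hF, hFf⟩, hmem⟩
  · intro h e he
    rw [h] at he
    obtain ⟨F, ⟨hF, hFf⟩, hmem⟩ := Set.mem_iUnion₂.1 he
    exact ⟨F, hF, hFf, hmem⟩

/-- The radicals of finite subsystems are directed, since Rad(F ∪ G) bounds Rad(F) and Rad(G). Their
union contains `S`; once it is a radical ideal it contains Rad(S). -/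
theorem radFinitary_of_directed_unions (B : Alg.{u, v, max u w} L)
    (h : ∀ (n : ℕ) (I : Type (max u w)) [PartialOrder I] [IsDirectedOrder I] [Nonempty I]
      (S : I → Set (Eqn L n)), (∀ i, IsRadicalIdeal B (S i)) →
      (∀ i j, i ≤ j ↔ S i ⊆ S j) → IsRadicalIdeal B (⋃ i, S i)) : RadFinitary B := by
  intro n S e he
  -- The index is the radical itself, not the finite subsystem: distinct subsystems may share a
  -- radical, and the order must agree with inclusion of radicals.
  let I := {R : ULift.{max u w} (Set (Eqn L n)) // ∃ F ⊆ S, F.Finite ∧ R.down = rad B F}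
  have hdir : IsDirectedOrder I := ⟨by
    rintro ⟨R, F, hF, hFf, hR⟩ ⟨R', G, hG, hGf, hR'⟩
    exact ⟨⟨⟨rad B (F ∪ G)⟩, F ∪ G, Set.union_subset hF hG, hFf.union hGf, rfl⟩,
      hR.le.trans (rad_mono B Set.subset_union_left),
      hR'.le.trans (rad_mono B Set.subset_union_right)⟩⟩
  have hne : Nonempty I := ⟨⟨⟨rad B ∅⟩, ∅, Set.empty_subset _, Set.finite_empty, rfl⟩⟩
  have hU := h n I (fun R => R.1.down) (by
    rintro ⟨R, F, hF, hFf, hR⟩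
    change R.down = rad B R.down
    rw [hR, rad_rad]) (fun _ _ => Iff.rfl)
  have hS : S ⊆ ⋃ R : I, R.1.down := fun p hp =>
    Set.mem_iUnion.2 ⟨⟨⟨rad B {p}⟩, {p}, Set.singleton_subset_iff.2 hp, Set.finite_singleton p,
      rfl⟩, subset_rad B _ rfl⟩
  have he' := rad_mono B hS he
  rw [← hU] at he'
  obtain ⟨⟨R, F, hF, hFf, hR⟩, hmem⟩ := Set.mem_iUnion.1 he'
  exact ⟨F, hF, hFf, hR.le hmem⟩

end Radicals

/-! ### Coordinate algebras as finitely generated separated algebras -/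

section CoordinateAlgebras

variable {L : FirstOrder.Language.{u, v}} [L.IsAlgebraic]

/-- The projection of the term algebra onto the coordinate algebra. -/
def coordHom (B : Alg.{u, v, c} L) {n : ℕ} (Y : Set (Fin n → B)) :
    L.Term (Fin n) →[L] CoordAlg B Y where
  toFun t := Quotient.mk _ t
  map_fun' f x := (funMap_quotient_mk' (radSetoid B Y) f x).symm
  map_rel' r := isEmptyElim r

theorem coordHom_surjective (B : Alg.{u, v, c} L) {n : ℕ} (Y : Set (Fin n → B)) :
    Function.Surjective (coordHom B Y) := Quotient.mk_surjective

theorem coordHom_eq_iff (B : Alg.{u, v, c} L) {n : ℕ} (Y : Set (Fin n → B))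
    (t s : L.Term (Fin n)) : coordHom B Y t = coordHom B Y s ↔ (t, s) ∈ radSet B Y :=
  Quotient.eq (r := radSetoid B Y)

/-- The coordinate algebras over `B` are the finitely generated algebras separated by `B`. -/
theorem isCoordinateAlgebra_iff (B C : Alg.{u, v, c} L) :
    IsCoordinateAlgebra B C ↔ C ∈ Res {B} ∧ Structure.FG L C := by
  constructor
  · rintro ⟨n, Y, -, ⟨f⟩⟩
    constructor
    · intro x y hxy
      obtain ⟨t, ht⟩ := coordHom_surjective B Y (f x)
      obtain ⟨s, hs⟩ := coordHom_surjective B Y (f y)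
      have hne : coordHom B Y t ≠ coordHom B Y s := by rw [ht, hs]; exact f.injective.ne hxy
      rw [Ne, coordHom_eq_iff] at hne
      obtain ⟨b, hb, hbe⟩ := Set.not_subset.1 hne
      obtain ⟨k, hk⟩ := exists_factor (coordHom B Y) (coordHom_surjective B Y) (evalHom b)
        fun t s h => (coordHom_eq_iff B Y t s).1 h hb
      refine ⟨B, rfl, k.comp f.toHom, ?_⟩
      change k (f x) ≠ k (f y)
      rw [← ht, ← hs, hk, hk]
      exact hbe
    · rw [f.fg_iff, Structure.fg_def, Substructure.fg_iff_exists_fin_generating_family]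
      refine ⟨n, coordHom B Y ∘ Term.var, ?_⟩
      rw [← surjective_evalHom_iff]
      intro x
      obtain ⟨t, rfl⟩ := coordHom_surjective B Y x
      exact ⟨t, (hom_eq_realize (coordHom B Y) t).symm⟩
  · rintro ⟨hC, hfg⟩
    rw [Structure.fg_def, Substructure.fg_iff_exists_fin_generating_family] at hfg
    obtain ⟨n, x, hx⟩ := hfg
    rw [← surjective_evalHom_iff] at hx
    -- With all relations among the generators in `S`, the points of V(S) correspond to the
    -- homomorphisms from `C` to `B`.
    let S : Set (Eqn L n) := {e | e.1.realize x = e.2.realize x}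
    refine ⟨n, solSet B S, ⟨S, rfl⟩, nonempty_equiv_of_ker_eq (evalHom x) hx
      (coordHom B _) (coordHom_surjective B _) fun t s => ?_⟩
    rw [coordHom_eq_iff]
    constructor
    · intro h b hb
      exact hb (t, s) h
    · intro h
      by_contra hne
      obtain ⟨A, rfl, k, hk⟩ := hC _ _ hne
      refine hk ?_
      rw [evalHom_apply, evalHom_apply, ← HomClass.realize_term k, ← HomClass.realize_term k]
      refine h fun p hp => ?_
      rw [HomClass.realize_term k, HomClass.realize_term k]
      exact congrArg k hp

end CoordinateAlgebras

/-! ### Direct systems of images in powers of B -/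

section ImageSystem

variable {L : FirstOrder.Language.{u, v}} {B : Alg.{u, v, c} L} {J : Type c} {T : Type w}
  [L.IsAlgebraic] [L.Structure T] (ev : J → T →[L] B)

/-- The homomorphism into a power of `B` given by a set of homomorphisms into `B`. -/
def powerHom (P : Set J) : T →[L] Alg.pi fun _ : P => B where
  toFun t j := ev j t
  map_fun' f x := funext fun j => (ev j).map_fun f x
  map_rel' r := isEmptyElim r

/-- The image of `T` in the power of `B` given by a set of homomorphisms into `B`. -/
def imageAlg [Nonempty T] (P : Set J) : Alg.{u, v, c} L where
  Carrier := (powerHom ev P).range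
  nonempty := ⟨⟨_, Classical.arbitrary T, rfl⟩⟩

/-- The projection of `T` onto its image. -/
def toImageAlg [Nonempty T] (P : Set J) : T →[L] imageAlg ev P :=
  (powerHom ev P).codRestrict (powerHom ev P).range fun t => ⟨t, rfl⟩

theorem toImageAlg_surjective [Nonempty T] (P : Set J) :
    Function.Surjective (toImageAlg ev P) := by
  rintro ⟨_, t, rfl⟩
  exact ⟨t, rfl⟩

theorem toImageAlg_eq_iff [Nonempty T] (P : Set J) (t s : T) :
    toImageAlg ev P t = toImageAlg ev P s ↔ ∀ j ∈ P, ev j t = ev j s := by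
  constructor
  · intro h j hj
    exact congrFun (congrArg Subtype.val h) ⟨j, hj⟩
  · intro h
    exact Subtype.ext (funext fun j => h j j.2)

theorem imageAlg_mem_Res [Nonempty T] (P : Set J) : imageAlg ev P ∈ Res {B} :=
  Res_of_injective (powerHom ev P).range.subtype.toHom Subtype.val_injective
    (pi_mem_Res _ fun _ => subset_Res _ rfl)

/-- The restriction of the coordinates, as a map of images of `T`. -/
def imageMap [Nonempty T] {P Q : Set J} (h : Q ⊆ P) : imageAlg ev P →[L] imageAlg ev Q where
  toFun x := ⟨fun j => x.1 ⟨j, h j.2⟩, by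
    obtain ⟨_, t, rfl⟩ := x
    exact ⟨t, rfl⟩⟩
  map_fun' _ _ := rfl
  map_rel' r := isEmptyElim r

variable {I : Type c} [PartialOrder I] [IsDirectedOrder I] [Nonempty I] {P : I → Set J}
  (hP : Antitone P)

/-- The epimorphic direct system of the images of `T` given by a decreasing family of sets of
homomorphisms into `B`. -/
def imageSystem [Nonempty T] : DirectSystem.{u, v, c} L where
  I := I
  obj i := imageAlg ev (P i)
  map h := imageMap ev (hP h)
  map_id _ _ := rfl
  map_map _ _ _ := rfl

theorem imageSystem_isEpimorphic [Nonempty T] : (imageSystem ev hP).IsEpimorphic := by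
  intro i j h y
  obtain ⟨t, rfl⟩ := toImageAlg_surjective ev (P j) y
  exact ⟨toImageAlg ev (P i) t, rfl⟩

/-- Every stage is a quotient of `T` and the kernels grow with the index, so the limit is `T` modulo
the union of the kernels; the projection does not depend on the stage through which it is defined.
-/
theorem exists_hom_imageSystem_limit [Nonempty T] :
    ∃ q : T →[L] (imageSystem ev hP).limit, Function.Surjective q ∧
      ∀ t s, q t = q s ↔ ∃ i, ∀ j ∈ P i, ev j t = ev j s := by
  have hq : ∀ (i i' : I) (t : T), (imageSystem ev hP).toLimit i (toImageAlg ev (P i) t) =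
      (imageSystem ev hP).toLimit i' (toImageAlg ev (P i') t) := fun i i' t => by
    obtain ⟨k, hk, hk'⟩ := exists_ge_ge i i'
    exact ((imageSystem ev hP).toLimit_map (i := i) (j := k) hk _).symm.trans
      ((imageSystem ev hP).toLimit_map (i := i') (j := k) hk' (toImageAlg ev (P i') t))
  let i₀ : I := Classical.arbitrary I
  refine ⟨((imageSystem ev hP).toLimit i₀).comp (toImageAlg ev (P i₀)), fun y => ?_,
    fun t s => ?_⟩
  · obtain ⟨i, x, rfl⟩ := (imageSystem ev hP).exists_toLimit y
    obtain ⟨t, rfl⟩ := toImageAlg_surjective ev (P i) x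
    exact ⟨t, hq i₀ i t⟩
  · constructor
    · intro h
      obtain ⟨k, hk, e⟩ := ((imageSystem ev hP).toLimit_eq_iff i₀ _ _).1 h
      exact ⟨k, (toImageAlg_eq_iff ev (P k) t s).1 e⟩
    · rintro ⟨i, hi⟩
      exact (hq i₀ i t).trans ((congrArg ((imageSystem ev hP).toLimit i)
        ((toImageAlg_eq_iff ev (P i) t s).2 hi)).trans (hq i i₀ s))

end ImageSystem

/-! ### Limits of separated algebras, quasivarieties and compactness -/

section Limits

variable {L : FirstOrder.Language.{u, v}} [L.IsAlgebraic]

/-- Every algebra of the quasivariety of `B` is an epimorphic direct limit of algebras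
separated by `B`. -/
theorem Qvar_subset_opLs (B : Alg.{u, v, max u w} L) : Qvar {B} ⊆ opLs (Res {B}) := by
  classical
  intro C hC
  -- `C` is presented with all its elements as variables and all its true equations as relations; `P
  -- F` is the solution set in `B` of finitely many of these relations.
  let P : Finset {p : L.Term C × L.Term C // p.1.realize id = p.2.realize id} → Set (C → B) :=
    fun F => {b | ∀ p ∈ F, p.1.1.realize b = p.1.2.realize b}
  have hP : Antitone P := fun F G h b hb p hp => hb p (h hp)
  have : Nonempty (L.Term C) := ⟨Term.var (Classical.arbitrary C)⟩
  let ev : (C → B) → L.Term C →[L] B := fun b => evalHom b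
  obtain ⟨q, hq, hker⟩ := exists_hom_imageSystem_limit ev hP
  refine ⟨imageSystem ev hP, imageSystem_isEpimorphic ev hP, fun i => imageAlg_mem_Res ev (P i),
    nonempty_equiv_of_ker_eq (evalHom id) (fun x => ⟨Term.var x, rfl⟩) q hq fun t s => ?_⟩
  rw [hker]
  constructor
  · intro h
    exact ⟨{⟨(t, s), h⟩}, fun b hb => hb ⟨(t, s), h⟩ (Finset.mem_singleton_self _)⟩
  · rintro ⟨F, hF⟩
    -- Equality at stage `F` says that the implication from `F` to `t = s` holds in `B`; it
    -- therefore holds in `C`, where the identity assignment satisfies `F`.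
    refine realize_eq_of_mem_Qvar hC (F.image Subtype.val) (t, s) ?_ id ?_
    · rintro A rfl b hb
      exact hF b fun p hp => hb p (Finset.mem_image_of_mem _ hp)
    · intro p hp
      obtain ⟨p, -, rfl⟩ := Finset.mem_image.1 hp
      exact p.2

theorem opLs_Res_singleton (B : Alg.{u, v, max u w} L) : opLs (Res {B}) = Qvar {B} :=
  (((opLs_subset_opL _).trans (opL_mono (Res_subset_Qvar _))).trans (opL_Qvar_subset _)).antisymm
    (Qvar_subset_opLs.{u, v, w} B)

theorem opL_Res_singleton (B : Alg.{u, v, max u w} L) : opL (Res {B}) = Qvar {B} :=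
  ((opL_mono (Res_subset_Qvar _)).trans (opL_Qvar_subset _)).antisymm
    ((Qvar_subset_opLs.{u, v, w} B).trans (opLs_subset_opL _))

theorem fgPart_Qvar_eq_iff_isCoordinateAlgebra (B : Alg.{u, v, c} L) :
    fgPart (Qvar {B}) = fgPart (Res {B}) ↔
      ∀ C ∈ Qvar {B}, Structure.FG L C → IsCoordinateAlgebra B C := by
  constructor
  · intro h C hC hfg
    have hmem : C ∈ fgPart (Qvar {B}) := ⟨hC, hfg⟩
    rw [h] at hmem
    exact (isCoordinateAlgebra_iff B C).2 hmem
  · intro h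
    exact Set.Subset.antisymm (fun C hC => (isCoordinateAlgebra_iff B C).1 (h C hC.1 hC.2))
      fun C hC => ⟨Res_subset_Qvar _ hC.1, hC.2⟩

/-- An equation failing at the generators of `C` is not in the radical of their relations: otherwise
finitely many relations would imply it over `B`, hence in `C`. A point of `B` where it fails gives
the separating homomorphism. -/
theorem RadFinitary.isCoordinateAlgebra {B : Alg.{u, v, c} L} (h : RadFinitary B)
    {C : Alg.{u, v, c} L} (hC : C ∈ Qvar {B}) (hfg : Structure.FG L C) :
    IsCoordinateAlgebra B C := by
  refine (isCoordinateAlgebra_iff B C).2 ⟨?_, hfg⟩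
  rw [Structure.fg_def, Substructure.fg_iff_exists_fin_generating_family] at hfg
  obtain ⟨n, x, hx⟩ := hfg
  rw [← surjective_evalHom_iff] at hx
  let S : Set (Eqn L n) := {e | e.1.realize x = e.2.realize x}
  intro y z hyz
  obtain ⟨t, rfl⟩ := hx y
  obtain ⟨s, rfl⟩ := hx z
  have hts : (t, s) ∉ rad B S := fun hts => by
    obtain ⟨Sc, hSc, hfin, hmem⟩ := h n S (t, s) hts
    refine hyz (mem_Qvar_iff.1 hC n hfin.toFinset (t, s) ?_ x ?_)
    · rintro A rfl b hb
      exact hmem fun p hp => hb p (hfin.mem_toFinset.2 hp)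
    · intro p hp
      exact hSc (hfin.mem_toFinset.1 hp)
  obtain ⟨b, hb, hne⟩ := Set.not_subset.1 hts
  obtain ⟨k, hk⟩ := exists_factor (evalHom x) hx (evalHom b) fun t s h => hb (t, s) h
  refine ⟨B, rfl, k, ?_⟩
  rw [hk, hk]
  exact hne

/-- The hypothesis is applied to the images of the term algebra in the powers of `B` over V(F), with
F finite in `S`. Two terms agree in the limit exactly when their equation lies in some Rad(F). -/
theorem radFinitary_of_limits (B : Alg.{u, v, max u w} L)
    (h : ∀ (n : ℕ) (D : DirectSystem.{u, v, max u w} L) (x : ∀ i, Fin n → D.obj i),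
      D.IsEpimorphic → (∀ i, IsCoordinateAlgebra B (D.obj i)) →
      (∀ i, Substructure.closure L (Set.range (x i)) = ⊤) →
      (∀ (i j : D.I) (h : i ≤ j) (k : Fin n), D.map h (x i k) = x j k) →
      IsCoordinateAlgebra B D.limit) : RadFinitary B := by
  classical
  intro n S e he
  have : Nonempty (L.Term (Fin n)) := ⟨e.1⟩
  let P : Finset (ULift.{max u w} S) → Set (Fin n → B) :=
    fun F => {b | ∀ p ∈ F, p.down.1.1.realize b = p.down.1.2.realize b}
  have hP : Antitone P := fun F G h b hb p hp => hb p (h hp)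
  let ev : (Fin n → B) → L.Term (Fin n) →[L] B := fun b => evalHom b
  obtain ⟨q, -, hker⟩ := exists_hom_imageSystem_limit ev hP
  have hgen : ∀ i, Substructure.closure L
      (Set.range (toImageAlg ev (P i) ∘ Term.var)) = ⊤ := fun i => by
    rw [← surjective_evalHom_iff]
    intro y
    obtain ⟨t, rfl⟩ := toImageAlg_surjective ev (P i) y
    exact ⟨t, (hom_eq_realize (toImageAlg ev (P i)) t).symm⟩
  have hlim := ((isCoordinateAlgebra_iff B _).1 (h n (imageSystem ev hP)
    (fun i => toImageAlg ev (P i) ∘ Term.var) (imageSystem_isEpimorphic ev hP)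
    (fun i => (isCoordinateAlgebra_iff B _).2 ⟨imageAlg_mem_Res ev (P i),
      Structure.fg_def.2 (Substructure.fg_iff_exists_fin_generating_family.2 ⟨n, _, hgen i⟩)⟩)
    hgen (fun _ _ _ _ => rfl))).1
  have hqe : q e.1 = q e.2 := by
    by_contra hne
    obtain ⟨A, rfl, k, hk⟩ := hlim _ _ hne
    -- A homomorphism from the limit to `B` is evaluation at a point. Each `p ∈ S` holds from stage
    -- `{p}` on, so the point lies in V(S) and satisfies `e`.
    have hkq : ∀ t, k (q t) = t.realize ((k.comp q) ∘ Term.var) := hom_eq_realize (k.comp q)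
    rw [hkq, hkq] at hk
    refine hk (he fun p hp => ?_)
    rw [← hkq, ← hkq]
    refine congrArg k ((hker _ _).2 ⟨{⟨⟨p, hp⟩⟩}, fun b hb => ?_⟩)
    exact hb _ (Finset.mem_singleton_self _)
  obtain ⟨F, hF⟩ := (hker _ _).1 hqe
  refine ⟨(fun p : ULift.{max u w} S => p.down.1) '' F, ?_, F.finite_toSet.image _, ?_⟩
  · rintro _ ⟨p, -, rfl⟩
    exact p.down.2
  · intro b hb
    exact hF b fun p hp => hb _ ⟨p, hp, rfl⟩

/-- A limit of algebras generated by compatible images of one finite set is finitely generated. -/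
theorem DirectSystem.limit_fg (D : DirectSystem.{u, v, c} L) {n : ℕ}
    (x : ∀ i, Fin n → D.obj i) (hx : ∀ i, Substructure.closure L (Set.range (x i)) = ⊤)
    (hmap : ∀ (i j : D.I) (h : i ≤ j) (k : Fin n), D.map h (x i k) = x j k) :
    Structure.FG L D.limit := by
  let i₀ : D.I := Classical.arbitrary D.I
  have hx₀ : ∀ i, D.toLimit i ∘ x i = D.toLimit i₀ ∘ x i₀ := fun i => by
    obtain ⟨k, hk, hk'⟩ := exists_ge_ge i i₀
    refine funext fun m => ?_
    change D.toLimit i (x i m) = D.toLimit i₀ (x i₀ m)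
    rw [← D.toLimit_map hk, ← D.toLimit_map hk', hmap, hmap]
  refine Structure.fg_def.2 (Substructure.fg_iff_exists_fin_generating_family.2
    ⟨n, D.toLimit i₀ ∘ x i₀, ?_⟩)
  rw [← surjective_evalHom_iff]
  intro y
  obtain ⟨i, z, rfl⟩ := D.exists_toLimit y
  obtain ⟨t, rfl⟩ := (surjective_evalHom_iff (x i)).2 (hx i) z
  refine ⟨t, ?_⟩
  rw [evalHom_apply, ← hx₀ i, evalHom_apply, HomClass.realize_term (D.toLimit i)]

end Limits

end UAG

/-- The following conditions on an algebra `B` in a functional language `L` are equivalent.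
Classes of algebras are taken in a universe that holds `B` and the terms of `L`. -/
theorem theorem4p1 (L : FirstOrder.Language.{u, v}) [L.IsAlgebraic]
    (B : UAG.Alg.{u, v, max u w} L) :
    List.TFAE
      [ UAG.IsQOmegaCompact B,
        ∀ (n : ℕ) (S : Set (UAG.Eqn L n)) (e : UAG.Eqn L n), e ∈ UAG.rad B S →
          ∃ Sc : Set (UAG.Eqn L n), Sc ⊆ S ∧ Sc.Finite ∧ e ∈ UAG.rad B Sc,
        ∀ (n : ℕ) (S : Set (UAG.Eqn L n)) (e : UAG.Eqn L n),
          UAG.HoldsInfQuasiIdentity B S e →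
            ∃ Sc : Finset (UAG.Eqn L n), (Sc : Set (UAG.Eqn L n)) ⊆ S ∧
              FirstOrder.Language.Sentence.Realize B (UAG.quasiIdentity Sc e),
        ∀ (n : ℕ) (S : Set (UAG.Eqn L n)) (e : UAG.Eqn L n),
          UAG.FinitelySatisfiableIn B (UAG.Eqn.toFormula '' S ∪ {e.toFormula.not}) →
            UAG.SatisfiableIn B (UAG.Eqn.toFormula '' S ∪ {e.toFormula.not}),
        ∀ C ∈ UAG.Qvar {B}, FirstOrder.Language.Structure.FG L C → UAG.IsCoordinateAlgebra B C,
        UAG.fgPart (UAG.Qvar {B}) = UAG.fgPart (UAG.Pvar {B}),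
        UAG.Qvar {B} = UAG.opLfg (UAG.Res {B}),
        UAG.opLs (UAG.opS (UAG.opP {B})) = UAG.opLfg (UAG.opS (UAG.opP {B})),
        UAG.opL (UAG.opS (UAG.opP {B})) = UAG.opLfg (UAG.opS (UAG.opP {B})),
        ∀ (n : ℕ) (S : Set (UAG.Eqn L n)),
          UAG.rad B S = ⋃ S₀ ∈ {S₀ : Set (UAG.Eqn L n) | S₀ ⊆ S ∧ S₀.Finite}, UAG.rad B S₀,
        ∀ (n : ℕ) (I : Type (max u w)) [PartialOrder I] [IsDirectedOrder I] [Nonempty I]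
          (S : I → Set (UAG.Eqn L n)), (∀ i, UAG.IsRadicalIdeal B (S i)) →
          (∀ i j, i ≤ j ↔ S i ⊆ S j) → UAG.IsRadicalIdeal B (⋃ i, S i),
        ∀ (n : ℕ) (D : UAG.DirectSystem.{u, v, max u w} L) (x : ∀ i, Fin n → D.obj i),
          D.IsEpimorphic → (∀ i, UAG.IsCoordinateAlgebra B (D.obj i)) →
          (∀ i, FirstOrder.Language.Substructure.closure L (Set.range (x i)) = ⊤) →
          (∀ (i j : D.I) (h : i ≤ j) (k : Fin n), D.map h (x i k) = x j k) →
          UAG.IsCoordinateAlgebra B D.limit ] := by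
  have h12 := UAG.isQOmegaCompact_iff B
  have h23 := UAG.radFinitary_iff_quasiIdentity B
  have h24 := UAG.radFinitary_iff_satisfiableIn B
  have h2X := UAG.radFinitary_iff_rad_eq_iUnion B
  have h56 := UAG.fgPart_Qvar_eq_iff_isCoordinateAlgebra B
  have h67 := UAG.fgPart_Qvar_eq_iff B
  -- After these rewrites both limit conditions read `Qvar {B} = opLfg (Res {B})`, the same as the
  -- condition before them.
  rw [UAG.Pvar_singleton, UAG.opS_opP_singleton, UAG.opLs_Res_singleton.{u, v, w},
    UAG.opL_Res_singleton.{u, v, w}]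
  tfae_have 1 ↔ 2 := h12
  tfae_have 2 ↔ 3 := h23
  tfae_have 2 ↔ 4 := h24
  tfae_have 2 ↔ 10 := h2X
  tfae_have 6 ↔ 5 := h56
  tfae_have 6 ↔ 7 := h67
  tfae_have 7 ↔ 8 := Iff.rfl
  tfae_have 7 ↔ 9 := Iff.rfl
  tfae_have 2 → 5 := fun h _ hC hfg => UAG.RadFinitary.isCoordinateAlgebra h hC hfg
  tfae_have 2 → 11 := fun h _ _ _ _ _ S hS hle =>
    UAG.RadFinitary.isRadicalIdeal_iUnion h S hS fun i j hij => (hle i j).1 hij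
  tfae_have 11 → 2 := UAG.radFinitary_of_directed_unions.{u, v, w} B
  tfae_have 5 → 12 := fun h n D x _ hD hx hmap =>
    h D.limit (UAG.opL_Qvar_subset {B} ⟨D, fun i =>
      UAG.Res_subset_Qvar _ ((UAG.isCoordinateAlgebra_iff B _).1 (hD i)).1, ⟨.refl L _⟩⟩)
      (D.limit_fg x hx hmap)
  tfae_have 12 → 2 := UAG.radFinitary_of_limits.{u, v, w} B
  tfae_finish
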